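/- Let $P=\{x\in\mathbb R^n : y_i(x)=\boldsymbol a_i x+b_i\ge 0,\ i=1,\dots,m\}$ be a simple polytope: $P$ is bounded and of dimension $n$, none of the $m$ inequalities can be omitted (so that $F_i=P\cap\{y_i=0\}$, $i=1,\dots,m$, are exactly the facets of $P$), and every vertex of $P$ lies in exactly $n$ facets. For a vertex $v$ put $\omega_v=\{i : v\in F_i\}=\{i_1<\dots<i_n\}$ and $P_v=P\setminus\bigcup_{j\notin\omega_v}F_j$. Let $\mathbb R^n_{\geqslant}$ be the set of vectors of $\mathbb R^n$ with non-negative coordinates; a map defined on a subset of $\mathbb R^n_{\geqslant}$ is called smooth if it is the restriction of a $C^\infty$ map defined on an open subset of $\mathbb R^n$. A manifold with corners is a space with an atlas of homeomorphisms of open subsets onto open subsets of $\mathbb R^n_{\geqslant}$ with smooth transition maps, and a diffeomorphism of manifolds with corners is a homeomorphism that is smooth in charts in both directions. The linear smooth structure on $P$ is given by the charts $P_v\to\mathbb R^n_{\geqslant}$, $x\mapsto (y_{i_1}(x),\dots,y_{i_n}(x))$, and the quadratic smooth structure on $P$ is given by the charts $P_v\to\mathbb R^n_{\geqslant}$, $x\mapsto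 (\sqrt{y_{i_1}(x)},\dots,\sqrt{y_{i_n}(x)})$, where $v$ runs over all vertices of $P$. Then $P$ with the linear smooth structure is diffeomorphic, as a manifold with corners, to $P$ with the quadratic smooth structure. -/

import Mathlib

open scoped ContDiff Matrix

noncomputable section

namespace PolytopeCorners

/-! ### Manifolds with corners

`EuclideanQuadrant n` is the cone `ℝⁿ_≥` of vectors of `ℝⁿ` with nonnegative coordinates. -/

/-- A map `f` is smooth on a subset `W` of `ℝⁿ_≥` if it is the restriction to `W` of a
`C^∞` map defined on an open subset of `ℝⁿ`. -/
def SmoothOnQuadrant {n : ℕ} (f : EuclideanQuadrant n → EuclideanQuadrant n)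
    (W : Set (EuclideanQuadrant n)) : Prop :=
  ∃ (U : Set (EuclideanSpace ℝ (Fin n))) (g : EuclideanSpace ℝ (Fin n) → EuclideanSpace ℝ (Fin n)),
    IsOpen U ∧ ContDiffOn ℝ ∞ g U ∧ ∀ q ∈ W, q.1 ∈ U ∧ g q.1 = (f q).1

/-- A smooth structure of an `n`-dimensional manifold with corners on a space `Q`: an atlas of
homeomorphisms of open subsets of `Q` onto open subsets of `ℝⁿ_≥`, with smooth transition maps. -/
structure CornerStructure (n : ℕ) (Q : Type*) [TopologicalSpace Q] where
  /-- the charts of the atlas -/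
  charts : Set (OpenPartialHomeomorph Q (EuclideanQuadrant n))
  /-- the charts cover the space -/
  cover : ∀ x : Q, ∃ φ ∈ charts, x ∈ φ.source
  /-- the transition map `ψ ∘ φ⁻¹ : φ (U_φ ∩ U_ψ) → ψ (U_φ ∩ U_ψ)` is smooth -/
  compatible : ∀ φ ∈ charts, ∀ ψ ∈ charts,
    SmoothOnQuadrant (fun q => ψ (φ.symm q)) {q ∈ φ.target | φ.symm q ∈ ψ.source}

/-- A continuous map `F : Q → Q'` is smooth if all its coordinate expressions
`ψ ∘ F ∘ φ⁻¹ : φ (U_φ ∩ F⁻¹(U_ψ)) → ℝⁿ_≥` are smooth. -/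
def CornerStructure.IsSmooth {n : ℕ} {Q Q' : Type*} [TopologicalSpace Q] [TopologicalSpace Q']
    (S : CornerStructure n Q) (S' : CornerStructure n Q') (F : C(Q, Q')) : Prop :=
  ∀ φ ∈ S.charts, ∀ ψ ∈ S'.charts,
    SmoothOnQuadrant (fun q => ψ (F (φ.symm q))) {q ∈ φ.target | F (φ.symm q) ∈ ψ.source}

/-- A diffeomorphism of manifolds with corners: a homeomorphism that is smooth in both
directions. -/
def CornerStructure.IsDiffeomorphism {n : ℕ} {Q Q' : Type*} [TopologicalSpace Q]
    [TopologicalSpace Q'] (S : CornerStructure n Q) (S' : CornerStructure n Q')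
    (F : Q ≃ₜ Q') : Prop :=
  S.IsSmooth S' (F : C(Q, Q')) ∧ S'.IsSmooth S (F.symm : C(Q', Q))

/-! ### Simple polytopes -/

/-- A system of `m` affine inequalities `a_i x + b_i ≥ 0` on `ℝⁿ`; `A` is the matrix with rows
`a_i`. -/
structure HalfSpaceSystem (n m : ℕ) where
  /-- the matrix of linear parts -/
  A : Matrix (Fin m) (Fin n) ℝ
  /-- the constant terms -/
  b : Fin m → ℝ

namespace HalfSpaceSystem

variable {n m : ℕ} (P : HalfSpaceSystem n m)

/-- The affine function `y_i = a_i x + b_i`. -/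
def y (i : Fin m) (x : Fin n → ℝ) : ℝ := (P.A *ᵥ x) i + P.b i

/-- The intersection `P` of the half-spaces `y_i ≥ 0`. -/
def carrier : Set (Fin n → ℝ) := {x | ∀ i, 0 ≤ P.y i x}

/-- The set of indices `i` with `x ∈ F_i = {y_i = 0}`; at a vertex `v` this is `ω_v`. -/
def active (x : Fin n → ℝ) : Finset (Fin m) := {i | P.y i x = 0}

end HalfSpaceSystem

/-- A simple polytope of dimension `n` in `ℝⁿ` with `m` facets `F_i = P ∩ {y_i = 0}`. Vertices are
extreme points. -/
structure SimplePolytope (n m : ℕ) extends HalfSpaceSystem n m where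
  /-- `P` is bounded -/
  bounded : Bornology.IsBounded toHalfSpaceSystem.carrier
  /-- `P` has dimension `n` -/
  full_dim : (interior toHalfSpaceSystem.carrier).Nonempty
  /-- no inequality can be omitted, so that `F_1, …, F_m` are precisely the facets of `P`, listed
  without repetition -/
  irredundant : ∀ i, ∃ x, toHalfSpaceSystem.y i x < 0 ∧ ∀ j, j ≠ i → 0 ≤ toHalfSpaceSystem.y j x
  /-- every vertex lies in exactly `n` facets -/
  simple : ∀ v ∈ Set.extremePoints ℝ toHalfSpaceSystem.carrier,
    (toHalfSpaceSystem.active v).card = n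

namespace SimplePolytope

variable {n m : ℕ} (P : SimplePolytope n m)

lemma y_smooth (i : Fin m) : ContDiff ℝ ∞ (P.y i) := by
  unfold HalfSpaceSystem.y Matrix.mulVec dotProduct
  fun_prop

lemma y_continuous (i : Fin m) : Continuous (P.y i) := (P.y_smooth i).continuous

lemma mem_active {x : Fin n → ℝ} {i : Fin m} : i ∈ P.active x ↔ P.y i x = 0 := by
  simp [HalfSpaceSystem.active]

lemma y_combo (i : Fin m) (x z : Fin n → ℝ) (s t : ℝ) (h : s + t = 1) :
    P.y i (s • x + t • z) = s * P.y i x + t * P.y i z := by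
  have hb : P.b i = s * P.b i + t * P.b i := by rw [← add_mul, h, one_mul]
  simp only [HalfSpaceSystem.y, Matrix.mulVec_add, Matrix.mulVec_smul, Pi.add_apply,
    Pi.smul_apply, smul_eq_mul]
  linear_combination hb

/-- The vertices of `P`. -/
abbrev Vertex : Type := Set.extremePoints ℝ P.carrier

/-- The increasing enumeration `i_1 < … < i_n` of `ω_v`. -/
def idx (v : P.Vertex) : Fin n ↪o Fin m := (P.active v.1).orderEmbOfFin (P.simple v.1 v.2)

lemma idx_mem (v : P.Vertex) (k : Fin n) : P.idx v k ∈ P.active v.1 :=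
  Finset.orderEmbOfFin_mem _ _ _

lemma exists_idx (v : P.Vertex) {i : Fin m} (hi : i ∈ P.active v.1) : ∃ k, P.idx v k = i := by
  have h := Finset.range_orderEmbOfFin (P.active v.1) (P.simple v.1 v.2)
  have : i ∈ Set.range ((P.active v.1).orderEmbOfFin (P.simple v.1 v.2)) := by
    rw [h]; exact hi
  exact this

/-- The matrix `A_v` with rows `a_i`, `i ∈ ω_v`. -/
def vertexMatrix (v : P.Vertex) : Matrix (Fin n) (Fin n) ℝ := P.A.submatrix (P.idx v) id

/-- The affine map `y_v ↦ A_v⁻¹ (y_v - b_v)`, which recovers a point from its coordinates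
`y_i`, `i ∈ ω_v`. -/
def point (v : P.Vertex) (q : Fin n → ℝ) : Fin n → ℝ :=
  (P.vertexMatrix v)⁻¹ *ᵥ (fun k => q k - P.b (P.idx v k))

lemma vertexMatrix_isUnit (v : P.Vertex) : IsUnit (P.vertexMatrix v).det := by
  rw [isUnit_iff_ne_zero]
  intro hdet
  obtain ⟨d, hd, hAd⟩ := Matrix.exists_mulVec_eq_zero_iff.mpr hdet
  have hy : ∀ (i : Fin m) (t : ℝ), P.y i (v.1 + t • d) = P.y i v.1 + t * (P.A *ᵥ d) i := by
    intro i t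
    simp only [HalfSpaceSystem.y, Matrix.mulVec_add, Matrix.mulVec_smul, Pi.add_apply,
      Pi.smul_apply, smul_eq_mul]
    ring
  have hact : ∀ i ∈ P.active v.1, (P.A *ᵥ d) i = 0 := by
    intro i hi
    obtain ⟨k, rfl⟩ := P.exists_idx v hi
    exact congrFun hAd k
  have hnhds : ∀ᶠ t : ℝ in nhds 0, ∀ i : Fin m, 0 ≤ P.y i (v.1 + t • d) := by
    rw [Filter.eventually_all]
    intro i
    by_cases hi : i ∈ P.active v.1
    · refine Filter.Eventually.of_forall fun t => ?_
      rw [hy, hact i hi, mul_zero, add_zero]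
      exact v.2.1 i
    · have hpos : 0 < P.y i v.1 :=
        lt_of_le_of_ne (v.2.1 i) (fun h => hi (P.mem_active.mpr h.symm))
      have hc : Continuous fun t : ℝ => P.y i (v.1 + t • d) :=
        (P.y_continuous i).comp (by fun_prop)
      have := hc.tendsto 0
      simp only [zero_smul, add_zero] at this
      exact (this.eventually (lt_mem_nhds hpos)).mono fun t ht => ht.le
  obtain ⟨ε, hε, hball⟩ := Metric.eventually_nhds_iff.mp hnhds
  have h1 := hball (y := ε / 2) (by simp [abs_of_pos hε]; linarith)
  have h2 := hball (y := -(ε / 2)) (by simp [abs_of_pos hε]; linarith)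
  have hext := (mem_extremePoints.mp v.2).2 _ h1 _ h2
    ⟨1 / 2, 1 / 2, by norm_num, by norm_num, by norm_num, by
      ext k; simp only [Pi.add_apply, Pi.smul_apply, smul_eq_mul]; ring⟩
  have : (ε / 2) • d = 0 := by simpa using hext.1
  rcases smul_eq_zero.mp this with h | h
  · linarith
  · exact hd h

lemma y_point (v : P.Vertex) (q : Fin n → ℝ) (k : Fin n) :
    P.y (P.idx v k) (P.point v q) = q k := by
  have h : P.vertexMatrix v *ᵥ P.point v q = fun k => q k - P.b (P.idx v k) := by
    rw [point, Matrix.mulVec_mulVec, Matrix.mul_nonsing_inv _ (P.vertexMatrix_isUnit v),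
      Matrix.one_mulVec]
  have hk : (P.A *ᵥ P.point v q) (P.idx v k) = q k - P.b (P.idx v k) := congrFun h k
  rw [HalfSpaceSystem.y, hk]; ring

lemma point_y (v : P.Vertex) (x : Fin n → ℝ) :
    P.point v (fun k => P.y (P.idx v k) x) = x := by
  have h : (fun k => P.y (P.idx v k) x - P.b (P.idx v k)) = P.vertexMatrix v *ᵥ x := by
    funext k
    simp only [HalfSpaceSystem.y, add_sub_cancel_right]
    rfl
  rw [point, h, Matrix.mulVec_mulVec, Matrix.nonsing_inv_mul _ (P.vertexMatrix_isUnit v),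
    Matrix.one_mulVec]

lemma point_smooth (v : P.Vertex) : ContDiff ℝ ∞ (P.point v) := by
  unfold point Matrix.mulVec dotProduct
  fun_prop

lemma point_mem (v : P.Vertex) {q : Fin n → ℝ} (hq : ∀ k, 0 ≤ q k)
    (h : ∀ j ∉ P.active v.1, 0 < P.y j (P.point v q)) : P.point v q ∈ P.carrier := by
  intro i
  by_cases hi : i ∈ P.active v.1
  · obtain ⟨k, rfl⟩ := P.exists_idx v hi
    rw [y_point]; exact hq k
  · exact (h i hi).le

/-- Every point lies in `P_v` for some vertex `v`. -/
lemma exists_vertex (x : P.carrier) : ∃ v : P.Vertex, ∀ j ∉ P.active v.1, P.y j x.1 ≠ 0 := by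
  have hclosed : IsClosed P.carrier := by
    have : P.carrier = ⋂ i, {x | 0 ≤ P.y i x} := by
      ext x; simp [HalfSpaceSystem.carrier]
    rw [this]
    exact isClosed_iInter fun i => isClosed_le continuous_const (P.y_continuous i)
  have hcompact : IsCompact P.carrier := Metric.isCompact_of_isClosed_isBounded hclosed P.bounded
  let G : Set (Fin n → ℝ) := P.carrier ∩ ⋂ i ∈ P.active x.1, {z | P.y i z = 0}
  have hG : IsCompact G := hcompact.inter_right <|
    isClosed_biInter fun i _ => isClosed_eq (P.y_continuous i) continuous_const
  have hx : x.1 ∈ G := ⟨x.2, by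
    simp only [Set.mem_iInter]
    exact fun i hi => P.mem_active.mp hi⟩
  have hext : IsExtreme ℝ P.carrier G := by
    refine ⟨Set.inter_subset_left, ?_⟩
    rintro x₁ hx₁ x₂ hx₂ z hz ⟨s, t, hs, ht, hst, rfl⟩
    refine ⟨hx₁, ?_⟩
    simp only [Set.mem_iInter]
    intro i hi
    have h0 := hz.2
    simp only [Set.mem_iInter] at h0
    have h1 : P.y i (s • x₁ + t • x₂) = 0 := h0 i hi
    rw [P.y_combo i x₁ x₂ s t hst] at h1
    have := mul_nonneg hs.le (hx₁ i)
    have := mul_nonneg ht.le (hx₂ i)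
    have h2 : s * P.y i x₁ = 0 := by linarith
    exact (mul_eq_zero.mp h2).resolve_left hs.ne'
  obtain ⟨v, hv⟩ := hG.extremePoints_nonempty ⟨_, hx⟩
  refine ⟨⟨v, hext.extremePoints_subset_extremePoints hv⟩, fun j hj h => hj ?_⟩
  have h0 := hv.1.2
  simp only [Set.mem_iInter] at h0
  exact P.mem_active.mpr (h0 j (P.mem_active.mpr h))

/-! ### The linear smooth structure -/

open Classical in
/-- The chart with domain `P_v = P \ ⋃_{j ∉ ω_v} F_j` and coordinates `y_i`, `i ∈ ω_v`. -/
def linearChart (v : P.Vertex) : OpenPartialHomeomorph P.carrier (EuclideanQuadrant n) where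
  toFun x := ⟨WithLp.toLp 2 fun k => P.y (P.idx v k) x.1, fun k => x.2 (P.idx v k)⟩
  invFun q := if h : P.point v q.1.ofLp ∈ P.carrier then ⟨P.point v q.1.ofLp, h⟩ else ⟨v.1, v.2.1⟩
  source := {x | ∀ j ∉ P.active v.1, P.y j x.1 ≠ 0}
  target := {q | ∀ j ∉ P.active v.1, 0 < P.y j (P.point v q.1.ofLp)}
  map_source' x hx j hj := by
    simp only [P.point_y v x.1]
    exact lt_of_le_of_ne (x.2 j) (hx j hj).symm
  map_target' q hq j hj := by
    rw [dif_pos (P.point_mem v q.2 hq)]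
    exact (hq j hj).ne'
  left_inv' x hx := by
    have h : P.point v (fun k => P.y (P.idx v k) x.1) = x.1 := P.point_y v x.1
    apply Subtype.ext
    simp only [h]
    rw [dif_pos x.2]
  right_inv' q hq := by
    apply Subtype.ext
    ext k
    simp only [dif_pos (P.point_mem v q.2 hq)]
    exact P.y_point v q.1.ofLp k
  open_source := by
    have : {x : P.carrier | ∀ j ∉ P.active v.1, P.y j x.1 ≠ 0} =
        ⋂ j, ⋂ (_ : j ∉ P.active v.1), {x : P.carrier | P.y j x.1 ≠ 0} := by
      ext x; simp
    rw [this]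
    exact isOpen_iInter_of_finite fun j => isOpen_iInter_of_finite fun _ =>
      isOpen_ne_fun ((P.y_continuous j).comp continuous_subtype_val) continuous_const
  open_target := by
    have : {q : EuclideanQuadrant n | ∀ j ∉ P.active v.1, 0 < P.y j (P.point v q.1.ofLp)} =
        ⋂ j, ⋂ (_ : j ∉ P.active v.1),
          {q : EuclideanQuadrant n | 0 < P.y j (P.point v q.1.ofLp)} := by
      ext x; simp
    rw [this]
    exact isOpen_iInter_of_finite fun j => isOpen_iInter_of_finite fun _ =>
      isOpen_lt continuous_const ((P.y_continuous j).comp ((P.point_smooth v).continuous.comp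
        ((PiLp.continuous_ofLp 2 _).comp continuous_subtype_val)))
  continuousOn_toFun := by
    apply Continuous.continuousOn
    refine Continuous.subtype_mk ((PiLp.continuous_toLp 2 _).comp (continuous_pi fun k => ?_)) _
    exact (P.y_continuous _).comp continuous_subtype_val
  continuousOn_invFun := by
    rw [Topology.IsInducing.subtypeVal.continuousOn_iff]
    have hc : Continuous fun q : EuclideanQuadrant n => P.point v q.1.ofLp :=
      (P.point_smooth v).continuous.comp
        ((PiLp.continuous_ofLp 2 _).comp continuous_subtype_val)
    refine hc.continuousOn.congr fun q hq => ?_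
    simp only [Function.comp_apply, dif_pos (P.point_mem v q.2 hq)]

lemma linearChart_symm_val (v : P.Vertex) {q : EuclideanQuadrant n}
    (hq : q ∈ (P.linearChart v).target) :
    ((P.linearChart v).symm q).1 = P.point v q.1.ofLp := by
  exact congrArg Subtype.val (dif_pos (P.point_mem v q.2 hq))

lemma linearChart_apply (v : P.Vertex) (x : P.carrier) (k : Fin n) :
    (P.linearChart v x).1 k = P.y (P.idx v k) x.1 := rfl

/-- The linear smooth structure: the charts are `P_v` with coordinates `y_i`, `i ∈ ω_v`, for all
vertices `v`. -/
def linearStructure : CornerStructure n P.carrier where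
  charts := Set.range P.linearChart
  cover x := by
    obtain ⟨v, hv⟩ := P.exists_vertex x
    exact ⟨P.linearChart v, ⟨v, rfl⟩, hv⟩
  compatible := by
    rintro _ ⟨v, rfl⟩ _ ⟨w, rfl⟩
    refine ⟨Set.univ, fun q => WithLp.toLp 2 fun k => P.y (P.idx w k) (P.point v q.ofLp),
      isOpen_univ, ContDiff.contDiffOn ?_, ?_⟩
    · refine contDiff_euclidean.mpr fun k => ?_
      exact (P.y_smooth _).comp ((P.point_smooth v).comp PiLp.contDiff_ofLp)
    · rintro q ⟨hq, -⟩
      refine ⟨Set.mem_univ _, ?_⟩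
      ext k
      rw [P.linearChart_apply, P.linearChart_symm_val v hq]

/-! ### The quadratic smooth structure -/

/-- The homeomorphism of `ℝⁿ_≥` that takes the square root of each coordinate; its inverse squares
each coordinate. -/
def sqrtHomeomorph (n : ℕ) : EuclideanQuadrant n ≃ₜ EuclideanQuadrant n where
  toFun q := ⟨WithLp.toLp 2 fun k => √(q.1 k), fun k => Real.sqrt_nonneg _⟩
  invFun q := ⟨WithLp.toLp 2 fun k => q.1 k ^ 2, fun k => sq_nonneg _⟩
  left_inv q := by
    apply Subtype.ext; ext k; exact Real.sq_sqrt (q.2 k)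
  right_inv q := by
    apply Subtype.ext; ext k; exact Real.sqrt_sq (q.2 k)
  continuous_toFun := by
    refine Continuous.subtype_mk ((PiLp.continuous_toLp 2 _).comp (continuous_pi fun k => ?_)) _
    exact ((PiLp.continuous_apply 2 _ k).comp continuous_subtype_val).sqrt
  continuous_invFun := by
    refine Continuous.subtype_mk ((PiLp.continuous_toLp 2 _).comp (continuous_pi fun k => ?_)) _
    exact ((PiLp.continuous_apply 2 _ k).comp continuous_subtype_val).pow 2

/-- The chart with domain `P_v` and coordinates `u_i = √y_i`, `i ∈ ω_v`. -/
def quadraticChart (v : P.Vertex) : OpenPartialHomeomorph P.carrier (EuclideanQuadrant n) :=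
  (P.linearChart v).transHomeomorph (sqrtHomeomorph n)

lemma quadraticChart_apply (v : P.Vertex) (x : P.carrier) (k : Fin n) :
    (P.quadraticChart v x).1 k = √(P.y (P.idx v k) x.1) := rfl

lemma quadraticChart_symm_val (v : P.Vertex) {q : EuclideanQuadrant n}
    (hq : q ∈ (P.quadraticChart v).target) :
    ((P.quadraticChart v).symm q).1 = P.point v (fun k => q.1 k ^ 2) :=
  P.linearChart_symm_val v (q := (sqrtHomeomorph n).symm q) hq

open Classical in
/-- The quadratic smooth structure: the charts are `P_v` with coordinates `u_i = √y_i`, `i ∈ ω_v`,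
for all vertices `v`. -/
def quadraticStructure : CornerStructure n P.carrier where
  charts := Set.range P.quadraticChart
  cover x := by
    obtain ⟨v, hv⟩ := P.exists_vertex x
    exact ⟨P.quadraticChart v, ⟨v, rfl⟩, hv⟩
  compatible := by
    rintro _ ⟨v, rfl⟩ _ ⟨w, rfl⟩
    have hs : ∀ j, ContDiff ℝ ∞ fun q : EuclideanSpace ℝ (Fin n) =>
        P.y j (P.point v (fun k => q k ^ 2)) := fun j =>
      (P.y_smooth _).comp ((P.point_smooth v).comp (by fun_prop))
    refine ⟨⋂ j, ⋂ (_ : j ∉ P.active v.1),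
      {q : EuclideanSpace ℝ (Fin n) | 0 < P.y j (P.point v (fun k => q k ^ 2))},
      fun q => WithLp.toLp 2 fun k =>
        if h : P.idx w k ∈ P.active v.1 then q (P.exists_idx v h).choose
        else √(P.y (P.idx w k) (P.point v (fun k => q k ^ 2))), ?_, ?_, ?_⟩
    · exact isOpen_iInter_of_finite fun j => isOpen_iInter_of_finite fun _ =>
        isOpen_lt continuous_const (hs j).continuous
    · refine contDiffOn_euclidean.mpr fun k => ?_
      by_cases h : P.idx w k ∈ P.active v.1
      · simp only [dif_pos h]
        fun_prop
      · simp only [dif_neg h]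
        refine (hs _).contDiffOn.sqrt fun q hq => ?_
        simp only [Set.mem_iInter] at hq
        exact (hq _ h).ne'
    · rintro q ⟨hq, -⟩
      refine ⟨?_, ?_⟩
      · simp only [Set.mem_iInter]
        exact fun j hj => hq j hj
      · ext k
        rw [P.quadraticChart_apply, P.quadraticChart_symm_val v hq]
        by_cases h : P.idx w k ∈ P.active v.1
        · simp only [dif_pos h]
          have hc := (P.exists_idx v h).choose_spec
          conv_rhs => rw [← hc, P.y_point]
          exact (Real.sqrt_sq (q.2 _)).symm
        · simp only [dif_neg h]

end SimplePolytope

end PolytopeCorners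

end

noncomputable section

namespace PolytopeCorners

open Filter Topology Set
open scoped Manifold

/-! ### Smooth maps between subsets of the quadrant -/

/-! The model is the nonnegative part of a toric variety, although the normals `aᵢ` need not be
rational. Near a vertex `v`, write the linear part of `yⱼ`, `j ∉ ω_v`, as a combination of the `aᵢ`,
`i ∈ ω_v`, with coefficients `c_jk`. The functions `t_k = y_{i_k} ∏ yⱼ^{c_jk}` (`toricCoord`) serve
as smooth coordinates for the linear structure, and their square roots do so for the quadratic one.
A homeomorphism that squares every `t_k`, at all vertices at once, is therefore the identity in
these coordinates.

Taking logarithms, the condition `t_k(w) = t_k(x)^p` becomes `∑ aᵢ log yᵢ(w) = p ∑ aᵢ log yᵢ(x)` in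
the interior, which mentions no vertex; `LogRel` is its version on every face, and `logRel_iff` is
the translation. For fixed interior `x` this is the critical point equation of the convex entropy `∑
(yᵢ log yᵢ - yᵢ - p log yᵢ(x) yᵢ)`. Its minimizer over the compact `P` is interior because `log`
tends to `-∞` at `0` (`exists_logRel_of_pos`). Solutions are unique because `log` is strictly
increasing (`LogRel.unique`), and the relation is closed under limits (`LogRel.of_tendsto`).
Closedness and compactness extend existence to the boundary and give continuity; exchanging `p` with
`p⁻¹` gives the inverse.

Smoothness follows from the inverse function theorem (`SmoothOnQuadrant.of_implicit`), since the
coordinate change to the `N`-th roots of the `t_k` has injective derivative up to the boundary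
(`toricMap_fderiv_injective`). This is used for `N = 1` and `N = 2`. -/

/-- Local smooth extensions can be glued with a partition of unity. -/
lemma SmoothOnQuadrant.of_local {n : ℕ} {f : EuclideanQuadrant n → EuclideanQuadrant n}
    {W : Set (EuclideanQuadrant n)}
    (h : ∀ q₀ ∈ W, ∃ U ∈ 𝓝 q₀.1, ∃ g : EuclideanSpace ℝ (Fin n) → EuclideanSpace ℝ (Fin n),
      ContDiffOn ℝ ∞ g U ∧ ∀ q ∈ W, q.1 ∈ U → g q.1 = (f q).1) :
    SmoothOnQuadrant f W := by
  classical
  have h' : ∀ q₀ ∈ W, ∃ U : Set (EuclideanSpace ℝ (Fin n)), IsOpen U ∧ q₀.1 ∈ U ∧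
      ∃ g : EuclideanSpace ℝ (Fin n) → EuclideanSpace ℝ (Fin n),
      ContDiffOn ℝ ∞ g U ∧ ∀ q ∈ W, q.1 ∈ U → g q.1 = (f q).1 := by
    intro q₀ hq₀
    obtain ⟨U, hU, g, hg, hgf⟩ := h q₀ hq₀
    obtain ⟨V, hVU, hV, hqV⟩ := mem_nhds_iff.mp hU
    exact ⟨V, hV, hqV, g, hg.mono hVU, fun q hq hqV => hgf q hq (hVU hqV)⟩
  choose! U hUo hqU g hg hgf using h'
  let Ω : TopologicalSpace.Opens (EuclideanSpace ℝ (Fin n)) :=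
    ⟨⋃ q ∈ W, U q, isOpen_biUnion hUo⟩
  have : SecondCountableTopology Ω := inferInstance
  have : LocallyCompactSpace Ω := Ω.isOpen.locallyCompactSpace
  -- The value is prescribed on `W` and free elsewhere. These constraints are convex, so averaging
  -- local extensions with a partition of unity preserves them.
  let t : Ω → Set (EuclideanSpace ℝ (Fin n)) :=
    fun x => {c | ∀ q ∈ W, q.1 = x.1 → c = (f q).1}
  have ht : ∀ x, Convex ℝ (t x) := by
    intro x c hc d hd a b _ _ hab q hq hqx
    rw [hc q hq hqx, hd q hq hqx, ← add_smul, hab, one_smul]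
  obtain ⟨G, hG⟩ := exists_contMDiffMap_forall_mem_convex_of_local (n := (⊤ : ℕ∞))
    (𝓘(ℝ, EuclideanSpace ℝ (Fin n))) ht (by
      intro x
      obtain ⟨q, hq, hx⟩ := mem_iUnion₂.mp x.2
      refine ⟨Subtype.val ⁻¹' U q,
        (hUo q hq).preimage continuous_subtype_val |>.mem_nhds hx, fun z => g q z.1, ?_, ?_⟩
      · refine fun z hz => ContMDiffAt.contMDiffWithinAt ?_
        exact contMDiffAt_subtype_iff.mpr
          (((hg q hq).contDiffAt ((hUo q hq).mem_nhds hz)).contMDiffAt)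
      · intro z hz q' hq' hqz
        have := hgf q hq q' hq' (hqz ▸ hz)
        rwa [hqz] at this)
  refine ⟨Ω, fun x => if hx : x ∈ Ω then G ⟨x, hx⟩ else 0, Ω.isOpen, ?_, ?_⟩
  · intro x hx
    refine ContDiffAt.contDiffWithinAt (ContMDiffAt.contDiffAt ?_)
    refine (contMDiffAt_subtype_iff (x := (⟨x, hx⟩ : Ω))).mp ?_
    refine (G.contMDiff ⟨x, hx⟩).congr_of_eventuallyEq (Eventually.of_forall fun z => ?_)
    simp
  · intro q hq
    have hqΩ : q.1 ∈ Ω := mem_iUnion₂.mpr ⟨q, hq, hqU q hq⟩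
    refine ⟨hqΩ, ?_⟩
    simp only [dif_pos hqΩ]
    exact hG ⟨q.1, hqΩ⟩ q hq rfl

lemma SmoothOnQuadrant.comp {n : ℕ} {f g : EuclideanQuadrant n → EuclideanQuadrant n}
    {W V : Set (EuclideanQuadrant n)} (hg : SmoothOnQuadrant g V) (hf : SmoothOnQuadrant f W)
    (hfW : MapsTo f W V) : SmoothOnQuadrant (fun q => g (f q)) W := by
  obtain ⟨U, F, hU, hF, hFf⟩ := hf
  obtain ⟨U', G, hU', hG, hGg⟩ := hg
  refine ⟨U ∩ F ⁻¹' U', fun x => G (F x), hF.continuousOn.isOpen_inter_preimage hU hU',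
    hG.comp (hF.mono inter_subset_left) fun x hx => hx.2, fun q hq => ?_⟩
  obtain ⟨hqU, hFq⟩ := hFf q hq
  obtain ⟨hgU, hGq⟩ := hGg (f q) (hfW hq)
  exact ⟨⟨hqU, by rw [mem_preimage, hFq]; exact hgU⟩, (congrArg G hFq).trans hGq⟩

lemma SmoothOnQuadrant.congr {n : ℕ} {f g : EuclideanQuadrant n → EuclideanQuadrant n}
    {W : Set (EuclideanQuadrant n)} (hg : SmoothOnQuadrant g W) (h : ∀ q ∈ W, f q = g q) :
    SmoothOnQuadrant f W := by
  obtain ⟨U, G, hU, hG, hGg⟩ := hg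
  exact ⟨U, G, hU, hG, fun q hq => ⟨(hGg q hq).1, by rw [h q hq]; exact (hGg q hq).2⟩⟩

lemma SmoothOnQuadrant.mono {n : ℕ} {f : EuclideanQuadrant n → EuclideanQuadrant n}
    {W V : Set (EuclideanQuadrant n)} (hf : SmoothOnQuadrant f V) (h : W ⊆ V) :
    SmoothOnQuadrant f W := by
  obtain ⟨U, G, hU, hG, hGg⟩ := hf
  exact ⟨U, G, hU, hG, fun q hq => hGg q (h hq)⟩

/-- A continuous solution `f` of `H (f q) = K q`, with `H` and `K` analytic and `H` of injective
derivative along `f`, is smooth. -/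
lemma SmoothOnQuadrant.of_implicit {n : ℕ} {f : EuclideanQuadrant n → EuclideanQuadrant n}
    {W : Set (EuclideanQuadrant n)} (hf : ContinuousOn f W)
    {K H : EuclideanSpace ℝ (Fin n) → EuclideanSpace ℝ (Fin n)}
    (hK : ∀ q ∈ W, ContDiffAt ℝ ω K q.1) (hH : ∀ q ∈ W, ContDiffAt ℝ ω H (f q).1)
    (hinj : ∀ q ∈ W, Function.Injective (fderiv ℝ H (f q).1))
    (heq : ∀ q ∈ W, H (f q).1 = K q.1) : SmoothOnQuadrant f W := by
  refine SmoothOnQuadrant.of_local fun q₀ hq₀ => ?_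
  let e : EuclideanSpace ℝ (Fin n) ≃L[ℝ] EuclideanSpace ℝ (Fin n) :=
    (LinearEquiv.ofInjectiveEndo (fderiv ℝ H (f q₀).1).toLinearMap
      (hinj q₀ hq₀)).toContinuousLinearEquiv
  have he : HasFDerivAt H (e : EuclideanSpace ℝ (Fin n) →L[ℝ] EuclideanSpace ℝ (Fin n))
      (f q₀).1 :=
    ((hH q₀ hq₀).differentiableAt (by simp)).hasFDerivAt
  let Φ := (hH q₀ hq₀).toOpenPartialHomeomorph H he (by simp)
  have hΦ : (f q₀).1 ∈ Φ.source :=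
    (hH q₀ hq₀).mem_toOpenPartialHomeomorph_source he (by simp)
  have hg : ContDiffAt ℝ ω (Φ.symm ∘ K) q₀.1 := by
    refine ContDiffAt.comp _ ?_ (hK q₀ hq₀)
    rw [← heq q₀ hq₀]
    exact (hH q₀ hq₀).to_localInverse he (by simp)
  -- Analyticity matters here: `ContDiffAt` with exponent `∞` would only give, for each finite
  -- order, its own neighbourhood.
  obtain ⟨U, hU, hgU⟩ := hg.contDiffOn le_rfl (by simp)
  -- Continuity of `f` keeps its values on the branch of solutions that the local inverse selects.
  have hfs : ∀ᶠ q in 𝓝[W] q₀, (f q).1 ∈ Φ.source :=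
    (continuous_subtype_val.continuousAt.comp_continuousWithinAt (hf q₀ hq₀)).eventually
      (Φ.open_source.mem_nhds hΦ)
  rw [eventually_nhdsWithin_iff, nhds_induced, eventually_comap] at hfs
  refine ⟨U ∩ {x | ∀ q : EuclideanQuadrant n, q.1 = x → q ∈ W → (f q).1 ∈ Φ.source},
    inter_mem hU hfs, Φ.symm ∘ K, (hgU.mono inter_subset_left).of_le le_top, ?_⟩
  rintro q hq ⟨-, hqs⟩
  rw [Function.comp_apply, ← heq q hq]
  exact Φ.left_inv (hqs q rfl hq)

namespace SimplePolytope

variable {n m : ℕ} (P : SimplePolytope n m)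

/-! ### The relation `∑ aᵢ log yᵢ(w) = p ∑ aᵢ log yᵢ(x)` -/

lemma mulVec_sub_apply (i : Fin m) (x z : Fin n → ℝ) :
    (P.A *ᵥ (x - z)) i = P.y i x - P.y i z := by
  simp only [HalfSpaceSystem.y, Matrix.mulVec_sub, Pi.sub_apply]
  ring

lemma y_add_smul (i : Fin m) (x d : Fin n → ℝ) (t : ℝ) :
    P.y i (x + t • d) = P.y i x + t * (P.A *ᵥ d) i := by
  simp only [HalfSpaceSystem.y, Matrix.mulVec_add, Matrix.mulVec_smul, Pi.add_apply,
    Pi.smul_apply, smul_eq_mul]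
  ring

lemma eq_of_y_eq {x w : Fin n → ℝ} (hx : x ∈ P.carrier) (h : ∀ i, P.y i x = P.y i w) :
    x = w := by
  obtain ⟨v, -⟩ := P.exists_vertex ⟨x, hx⟩
  rw [← P.point_y v x, ← P.point_y v w]
  simp only [h]

/-- The points `x` and `w` lie in the relative interior of the same face, and
`∑ aᵢ (log yᵢ(w) - p log yᵢ(x))` vanishes on the tangent space of that face, where the sum is over
the facets that do not contain the face. -/
def LogRel (p : ℝ) (x w : Fin n → ℝ) : Prop :=
  (∀ i, P.y i x = 0 ↔ P.y i w = 0) ∧ ∀ d, (∀ i, P.y i x = 0 → (P.A *ᵥ d) i = 0) →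
    ∑ i, (P.A *ᵥ d) i * (Real.log (P.y i w) - p * Real.log (P.y i x)) = 0

variable {P}

lemma LogRel.symm {p : ℝ} (hp : 0 < p) {x w : Fin n → ℝ} (h : P.LogRel p x w) :
    P.LogRel p⁻¹ w x := by
  refine ⟨fun i => (h.1 i).symm, fun d hd => ?_⟩
  have := h.2 d fun i hi => hd i ((h.1 i).mp hi)
  rw [← mul_zero (-p⁻¹), ← this, Finset.mul_sum]
  refine Finset.sum_congr rfl fun i _ => ?_
  field_simp
  ring

/-- Subtracting the two relations and testing on `w - w'`, which is tangent to the face, gives a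
vanishing sum of terms `(a - b) (log a - log b)`. Each is nonnegative, and positive unless `a = b`.
-/
lemma LogRel.unique {p : ℝ} {x w w' : Fin n → ℝ} (hw : w ∈ P.carrier) (hw' : w' ∈ P.carrier)
    (h : P.LogRel p x w) (h' : P.LogRel p x w') : w = w' := by
  refine P.eq_of_y_eq hw fun i => ?_
  have hd : ∀ i, P.y i x = 0 → (P.A *ᵥ (w - w')) i = 0 := fun i hi => by
    rw [P.mulVec_sub_apply, (h.1 i).mp hi, (h'.1 i).mp hi, sub_zero]
  have h0 : ∑ i, (P.y i w - P.y i w') * (Real.log (P.y i w) - Real.log (P.y i w')) = 0 := by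
    rw [← sub_zero (0 : ℝ)]
    nth_rewrite 1 [← h.2 _ hd]
    rw [← h'.2 _ hd, ← Finset.sum_sub_distrib]
    refine Finset.sum_congr rfl fun i _ => ?_
    rw [P.mulVec_sub_apply]
    ring
  have hpos : ∀ i, P.y i w ≠ P.y i w' →
      0 < (P.y i w - P.y i w') * (Real.log (P.y i w) - Real.log (P.y i w')) := by
    intro i hne
    have hi : P.y i x ≠ 0 := fun hi => hne (by rw [(h.1 i).mp hi, (h'.1 i).mp hi])
    have h1 : 0 < P.y i w := lt_of_le_of_ne (hw i) fun e => hi ((h.1 i).mpr e.symm)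
    have h2 : 0 < P.y i w' := lt_of_le_of_ne (hw' i) fun e => hi ((h'.1 i).mpr e.symm)
    rcases lt_or_gt_of_ne hne with hlt | hlt
    · exact mul_pos_of_neg_of_neg (sub_neg.mpr hlt) (sub_neg.mpr (Real.log_lt_log h1 hlt))
    · exact mul_pos (sub_pos.mpr hlt) (sub_pos.mpr (Real.log_lt_log h2 hlt))
  by_contra hne
  refine (Finset.sum_pos' (fun j _ => ?_) ⟨i, Finset.mem_univ _, hpos i hne⟩).ne' h0
  by_cases hj : P.y j w = P.y j w'
  · simp [hj]
  · exact (hpos j hj).le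

variable (P)

/-! ### Toric coordinates at a vertex -/

/-- The coefficients of the affine functions `yⱼ` in the coordinates `yᵢ`, `i ∈ ω_v`. -/
def vertexCoeff (v : P.Vertex) : Matrix (Fin m) (Fin n) ℝ := P.A * (P.vertexMatrix v)⁻¹

lemma mulVec_eq_vertexCoeff (v : P.Vertex) (d : Fin n → ℝ) (i : Fin m) :
    (P.A *ᵥ d) i = ∑ k, P.vertexCoeff v i k * (P.A *ᵥ d) (P.idx v k) := by
  have h : P.A *ᵥ d = P.vertexCoeff v *ᵥ (P.vertexMatrix v *ᵥ d) := by
    rw [vertexCoeff, Matrix.mulVec_mulVec, Matrix.mul_assoc,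
      Matrix.nonsing_inv_mul _ (P.vertexMatrix_isUnit v), Matrix.mul_one]
  exact congrFun h i

lemma y_point_add_smul (v : P.Vertex) (j : Fin m) (q d : Fin n → ℝ) :
    P.y j (P.point v (q + d)) =
      P.y j (P.point v q) + ∑ k, P.vertexCoeff v j k * d k := by
  have h : P.point v (q + d) = P.point v q + (P.vertexMatrix v)⁻¹ *ᵥ d := by
    rw [point, point, ← Matrix.mulVec_add]
    congr 1
    funext k
    simp only [Pi.add_apply]
    ring
  have h' := P.y_add_smul j (P.point v q) ((P.vertexMatrix v)⁻¹ *ᵥ d) 1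
  rw [one_smul, one_mul, Matrix.mulVec_mulVec] at h'
  rw [h, h']
  rfl

/-- The exponents `∑_{j ∉ ω_v} c_jk log yⱼ`. -/
def toricExponent (v : P.Vertex) (x : Fin n → ℝ) (k : Fin n) : ℝ :=
  ∑ j ∈ (P.active v.1)ᶜ, P.vertexCoeff v j k * Real.log (P.y j x)

/-- The coordinates of the nonnegative part of a toric variety, near a vertex. -/
def toricCoord (v : P.Vertex) (x : Fin n → ℝ) (k : Fin n) : ℝ :=
  P.y (P.idx v k) x * Real.exp (P.toricExponent v x k)

/-- This expands the covector `∑ lᵢ aᵢ` in the basis `aᵢ`, `i ∈ ω_v`. For `l = log y`, its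
coordinates are the logarithms of the toric coordinates. -/
lemma sum_mulVec_mul (v : P.Vertex) (d : Fin n → ℝ) (l : Fin m → ℝ) :
    ∑ i, (P.A *ᵥ d) i * l i = ∑ k, (P.A *ᵥ d) (P.idx v k) *
      (l (P.idx v k) + ∑ j ∈ (P.active v.1)ᶜ, P.vertexCoeff v j k * l j) := by
  rw [← Finset.sum_add_sum_compl (P.active v.1)]
  have h1 : ∑ i ∈ P.active v.1, (P.A *ᵥ d) i * l i =
      ∑ k, (P.A *ᵥ d) (P.idx v k) * l (P.idx v k) := by
    rw [← Finset.map_orderEmbOfFin_univ (P.active v.1) (P.simple v.1 v.2), Finset.sum_map]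
    rfl
  have h2 : ∑ i ∈ (P.active v.1)ᶜ, (P.A *ᵥ d) i * l i =
      ∑ k, (P.A *ᵥ d) (P.idx v k) * ∑ j ∈ (P.active v.1)ᶜ, P.vertexCoeff v j k * l j := by
    simp only [Finset.mul_sum]
    rw [Finset.sum_comm]
    refine Finset.sum_congr rfl fun j _ => ?_
    rw [P.mulVec_eq_vertexCoeff v d j, Finset.sum_mul]
    exact Finset.sum_congr rfl fun k _ => by ring
  rw [h1, h2, ← Finset.sum_add_distrib]
  exact Finset.sum_congr rfl fun k _ => by ring

lemma toricCoord_eq_rpow_iff (v : P.Vertex) {p : ℝ} {x w : Fin n → ℝ} {k : Fin n}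
    (hx : 0 < P.y (P.idx v k) x) (hw : 0 < P.y (P.idx v k) w) :
    P.toricCoord v w k = P.toricCoord v x k ^ p ↔
      Real.log (P.y (P.idx v k) w) - p * Real.log (P.y (P.idx v k) x) +
        ∑ j ∈ (P.active v.1)ᶜ, P.vertexCoeff v j k *
          (Real.log (P.y j w) - p * Real.log (P.y j x)) = 0 := by
  have hX : 0 < P.toricCoord v x k := mul_pos hx (Real.exp_pos _)
  have hW : 0 < P.toricCoord v w k := mul_pos hw (Real.exp_pos _)
  have hs : ∑ j ∈ (P.active v.1)ᶜ, P.vertexCoeff v j k *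
      (Real.log (P.y j w) - p * Real.log (P.y j x)) =
      P.toricExponent v w k - p * P.toricExponent v x k := by
    simp only [toricExponent, Finset.mul_sum, ← Finset.sum_sub_distrib]
    exact Finset.sum_congr rfl fun j _ => by ring
  have hl : ∀ z : Fin n → ℝ, 0 < P.y (P.idx v k) z → Real.log (P.toricCoord v z k) =
      Real.log (P.y (P.idx v k) z) + P.toricExponent v z k := fun z hz => by
    rw [toricCoord, Real.log_mul hz.ne' (Real.exp_pos _).ne', Real.log_exp]
  rw [← Real.log_injOn_pos.eq_iff hW (Real.rpow_pos_of_pos hX p), Real.log_rpow hX,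
    hl x hx, hl w hw, hs]
  constructor <;> intro h <;> linarith

/-- On the tangent space of the face of `x` only the coordinates with `y_{i_k}(x) ≠ 0` are free, and
for these the logarithm of the toric equation is a component of the relation. The other toric
coordinates vanish, matching `0 ^ p = 0`. -/
lemma logRel_iff (v : P.Vertex) {p : ℝ} (hp : 0 < p) {x w : Fin n → ℝ} (hx : x ∈ P.carrier)
    (hw : w ∈ P.carrier) (hxv : ∀ j ∉ P.active v.1, P.y j x ≠ 0)
    (hwv : ∀ j ∉ P.active v.1, P.y j w ≠ 0) :
    P.LogRel p x w ↔ ∀ k, P.toricCoord v w k = P.toricCoord v x k ^ p := by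
  have h0 : ∀ k, P.y (P.idx v k) x = 0 → P.toricCoord v x k ^ p = 0 := fun k hk => by
    rw [toricCoord, hk, zero_mul, Real.zero_rpow hp.ne']
  constructor
  · intro h k
    by_cases hk : P.y (P.idx v k) x = 0
    · rw [h0 k hk, toricCoord, (h.1 _).mp hk, zero_mul]
    rw [P.toricCoord_eq_rpow_iff v (lt_of_le_of_ne (hx _) (Ne.symm hk))
      (lt_of_le_of_ne (hw _) fun e => hk ((h.1 _).mpr e.symm))]
    -- The test direction is the edge vector dual to `a_{i_k}`: it moves `y_{i_k}` at unit speed and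
    -- fixes the other `yᵢ`, `i ∈ ω_v`.
    have hd : ∀ l, (P.A *ᵥ ((P.vertexMatrix v)⁻¹ *ᵥ Pi.single k 1)) (P.idx v l) =
        (Pi.single k 1 : Fin n → ℝ) l := by
      intro l
      have : P.vertexMatrix v *ᵥ ((P.vertexMatrix v)⁻¹ *ᵥ Pi.single k 1) = Pi.single k 1 := by
        rw [Matrix.mulVec_mulVec, Matrix.mul_nonsing_inv _ (P.vertexMatrix_isUnit v),
          Matrix.one_mulVec]
      exact congrFun this l
    have := h.2 ((P.vertexMatrix v)⁻¹ *ᵥ Pi.single k 1) fun i hi => by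
      have hiv : i ∈ P.active v.1 := by_contra fun hiv => hxv i hiv hi
      obtain ⟨l, rfl⟩ := P.exists_idx v hiv
      rw [hd, Pi.single_eq_of_ne]
      rintro rfl
      exact hk hi
    rw [P.sum_mulVec_mul v] at this
    simpa only [hd, Pi.single_apply, ite_mul, one_mul, zero_mul, Finset.sum_ite_eq',
      Finset.mem_univ, if_true] using this
  · intro h
    have hz : ∀ k, P.y (P.idx v k) x = 0 ↔ P.y (P.idx v k) w = 0 := by
      intro k
      have hX : 0 ≤ P.toricCoord v x k := mul_nonneg (hx _) (Real.exp_pos _).le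
      have h1 : P.toricCoord v w k = 0 ↔ P.toricCoord v x k = 0 := by
        rw [h k, Real.rpow_eq_zero hX hp.ne']
      simpa [toricCoord, Real.exp_ne_zero] using h1.symm
    refine ⟨fun i => ?_, fun d hd => ?_⟩
    · by_cases hi : i ∈ P.active v.1
      · obtain ⟨k, rfl⟩ := P.exists_idx v hi
        exact hz k
      · exact iff_of_false (hxv i hi) (hwv i hi)
    · rw [P.sum_mulVec_mul v]
      refine Finset.sum_eq_zero fun k _ => ?_
      by_cases hk : P.y (P.idx v k) x = 0
      · rw [hd _ hk, zero_mul]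
      · rw [(P.toricCoord_eq_rpow_iff v (lt_of_le_of_ne (hx _) (Ne.symm hk))
          (lt_of_le_of_ne (hw _) fun e => hk ((hz k).mpr e.symm))).mp (h k), mul_zero]

/-! ### Existence and continuity of solutions -/

lemma isCompact_carrier : IsCompact P.carrier := by
  refine Metric.isCompact_of_isClosed_isBounded ?_ P.bounded
  have : P.carrier = ⋂ i, {x | 0 ≤ P.y i x} := by
    ext x; simp [HalfSpaceSystem.carrier]
  rw [this]
  exact isClosed_iInter fun i => isClosed_le continuous_const (P.y_continuous i)

lemma exists_interior_point : ∃ x₀, ∀ i, 0 < P.y i x₀ := by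
  obtain ⟨x₀, hx₀⟩ := P.full_dim
  refine ⟨x₀, fun i => ?_⟩
  -- A point with `yᵢ < 0` rules out `yᵢ` being identically zero. A small move towards it from an
  -- interior point stays in `P`, which forces `yᵢ(x₀) > 0`.
  obtain ⟨z, hz, -⟩ := P.irredundant i
  have hc : Continuous fun t : ℝ => x₀ + t • (z - x₀) := by fun_prop
  have h1 : ∀ᶠ t in 𝓝[>] (0 : ℝ), x₀ + t • (z - x₀) ∈ interior P.carrier := by
    have := hc.tendsto 0
    rw [zero_smul, add_zero] at this
    exact (this.eventually (isOpen_interior.mem_nhds hx₀)).filter_mono nhdsWithin_le_nhds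
  obtain ⟨t, ht, ht0, ht1⟩ :=
    (h1.and (Ioo_mem_nhdsGT (zero_lt_one' ℝ))).exists
  have h2 := interior_subset ht i
  rw [P.y_add_smul, P.mulVec_sub_apply] at h2
  by_contra! h3
  nlinarith [mul_neg_of_pos_of_neg ht0 hz, mul_nonneg (sub_pos.mpr ht1).le (neg_nonneg.mpr h3)]

/-- Along a family of points that satisfy the entropy inequality, no coordinate `yⱼ` that stays
positive for `X` can tend to zero for `W`. -/
lemma y_ne_zero_of_tendsto {ι : Type*} {l : Filter ι} [l.NeBot] {p : ℝ} (hp : 0 < p)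
    {X W : ι → Fin n → ℝ} {x w : Fin n → ℝ} (hx : x ∈ P.carrier)
    (hX : ∀ a, X a ∈ P.carrier) (hW : ∀ a, W a ∈ P.carrier)
    (tX : Tendsto X l (𝓝 x)) (tW : Tendsto W l (𝓝 w))
    (hpos : ∀ᶠ a in l, ∀ i, P.y i x ≠ 0 → P.y i (W a) ≠ 0)
    (hsum : ∀ᶠ a in l, 0 ≤ ∑ i, (P.y i x - P.y i (W a)) *
      (Real.log (P.y i (W a)) - p * Real.log (P.y i (X a))))
    {j : Fin m} (hj : P.y j x ≠ 0) : P.y j w ≠ 0 := by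
  intro hjw
  have tyX : ∀ i, Tendsto (fun a => P.y i (X a)) l (𝓝 (P.y i x)) := fun i =>
    ((P.y_continuous i).tendsto x).comp tX
  have tyW : ∀ i, Tendsto (fun a => P.y i (W a)) l (𝓝 (P.y i w)) := fun i =>
    ((P.y_continuous i).tendsto w).comp tW
  set T : Fin m → ι → ℝ := fun i a => (P.y i x - P.y i (W a)) *
    (Real.log (P.y i (W a)) - p * Real.log (P.y i (X a))) with hT
  have hbot : ∀ i, P.y i x ≠ 0 → P.y i w = 0 → Tendsto (T i) l atBot := by
    intro i hi hiw
    have h1 : Tendsto (fun a => P.y i (W a)) l (𝓝[≠] 0) := by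
      refine tendsto_nhdsWithin_iff.mpr ⟨hiw ▸ tyW i, hpos.mono fun a ha => ha i hi⟩
    have h2 : Tendsto (fun a => Real.log (P.y i (W a)) - p * Real.log (P.y i (X a))) l atBot := by
      simp only [sub_eq_add_neg]
      exact (Real.tendsto_log_nhdsNE_zero.comp h1).atBot_add
        (((tyX i).log hi).const_mul p).neg
    refine Tendsto.pos_mul_atBot (C := P.y i x) (lt_of_le_of_ne (hx i) hi.symm) ?_ h2
    simpa [hiw] using (tyW i).const_sub (P.y i x)
  -- If `yᵢ(x) = 0`, the part `-yᵢ(W) log yᵢ(W)` converges and the cross term `p yᵢ(W) log yᵢ(X)` is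
  -- eventually nonpositive. Hence no term can compensate one that tends to `-∞`.
  have hbdd : ∀ i, ∃ C, ∀ᶠ a in l, T i a ≤ C := by
    intro i
    by_cases hi : P.y i x = 0
    · have h1 : Tendsto (fun a => -(P.y i (W a) * Real.log (P.y i (W a)))) l
          (𝓝 (-(P.y i w * Real.log (P.y i w)))) :=
        ((Real.continuous_mul_log.tendsto _).comp (tyW i)).neg
      refine ⟨-(P.y i w * Real.log (P.y i w)) + 1, ((h1.eventually (gt_mem_nhds (lt_add_one _))).and
        ((tyX i).eventually_lt_const (u := 1) (by rw [hi]; exact one_pos))).mono ?_⟩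
      rintro a ⟨ha, ha1⟩
      have h2 := Real.log_nonpos (hX a i) ha1.le
      have h3 : P.y i (W a) * (p * Real.log (P.y i (X a))) ≤ 0 :=
        mul_nonpos_of_nonneg_of_nonpos (hW a i) (mul_nonpos_of_nonneg_of_nonpos hp.le h2)
      refine le_trans ?_ ha.le
      simp only [hT, hi]
      linarith
    · by_cases hiw : P.y i w = 0
      · exact ⟨0, (hbot i hi hiw).eventually (eventually_le_atBot 0)⟩
      · have h1 : Tendsto (T i) l (𝓝 ((P.y i x - P.y i w) *
            (Real.log (P.y i w) - p * Real.log (P.y i x)))) :=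
          ((tyW i).const_sub _).mul (((tyW i).log hiw).sub (((tyX i).log hi).const_mul p))
        exact ⟨_, (h1.eventually (gt_mem_nhds (lt_add_one _))).mono fun a ha => ha.le⟩
  choose C hC using hbdd
  have hlt := (hbot j hj hjw).eventually
    (eventually_lt_atBot (-∑ i ∈ Finset.univ.erase j, C i))
  obtain ⟨a, ha, haC, hlt⟩ := (hsum.and ((eventually_all.mpr hC).and hlt)).exists
  have h1 : ∑ i ∈ Finset.univ.erase j, T i a ≤ ∑ i ∈ Finset.univ.erase j, C i :=
    Finset.sum_le_sum fun i _ => haC i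
  have h2 := Finset.add_sum_erase Finset.univ (fun i => T i a) (Finset.mem_univ j)
  have h3 : 0 ≤ ∑ i, T i a := ha
  linarith

lemma toricCoord_tendsto (v : P.Vertex) {ι : Type*} {l : Filter ι} {X : ι → Fin n → ℝ}
    {x : Fin n → ℝ} (tX : Tendsto X l (𝓝 x)) (hxv : ∀ j ∉ P.active v.1, P.y j x ≠ 0)
    (k : Fin n) :
    Tendsto (fun a => P.toricCoord v (X a) k) l (𝓝 (P.toricCoord v x k)) := by
  have tyX : ∀ i, Tendsto (fun a => P.y i (X a)) l (𝓝 (P.y i x)) := fun i =>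
    ((P.y_continuous i).tendsto x).comp tX
  refine (tyX _).mul ((Real.continuous_exp.tendsto _).comp ?_)
  exact tendsto_finsetSum _ fun j hj =>
    ((tyX j).log (hxv j (Finset.mem_compl.mp hj))).const_mul _

variable {P}

/-- The entropy inequality keeps the limit `w` off every facet that misses `x`. Both limits then lie
in the domain of one vertex chart, where the relation is an equation between continuous functions.
-/
lemma LogRel.of_tendsto {ι : Type*} {l : Filter ι} [l.NeBot] {p : ℝ} (hp : 0 < p)
    {X W : ι → Fin n → ℝ} {x w : Fin n → ℝ} (hx : x ∈ P.carrier) (hw : w ∈ P.carrier)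
    (hX : ∀ a, X a ∈ P.carrier) (hW : ∀ a, W a ∈ P.carrier)
    (tX : Tendsto X l (𝓝 x)) (tW : Tendsto W l (𝓝 w)) (h : ∀ a, P.LogRel p (X a) (W a)) :
    P.LogRel p x w := by
  have hne : ∀ᶠ a in l, ∀ i, P.y i x ≠ 0 → P.y i (X a) ≠ 0 := by
    rw [eventually_all]
    intro i
    rw [eventually_imp_distrib_left]
    exact fun hi => (((P.y_continuous i).tendsto x).comp tX).eventually_ne hi
  have hneW : ∀ᶠ a in l, ∀ i, P.y i x ≠ 0 → P.y i (W a) ≠ 0 :=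
    hne.mono fun a ha i hi h0 => ha i hi (((h a).1 i).mpr h0)
  have hxw : ∀ i, P.y i x ≠ 0 → P.y i w ≠ 0 := fun i hi => by
    refine P.y_ne_zero_of_tendsto hp hx hX hW tX tW hneW (hne.mono fun a ha => ?_) hi
    -- A facet through `X a` contains `W a` by the relation and, for `a` far along the filter,
    -- contains `x`; so this direction is admissible.
    have := (h a).2 (x - W a) fun i hi => by
      rw [P.mulVec_sub_apply, ((h a).1 i).mp hi, not_imp_not.mp (ha i) hi, sub_zero]
    simp only [P.mulVec_sub_apply] at this
    exact this.ge
  obtain ⟨v, hv⟩ := P.exists_vertex ⟨x, hx⟩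
  rw [P.logRel_iff v hp hx hw hv fun j hj => hxw j (hv j hj)]
  intro k
  refine tendsto_nhds_unique (P.toricCoord_tendsto v tW (fun j hj => hxw j (hv j hj)) k) ?_
  refine ((P.toricCoord_tendsto v tX hv k).rpow_const (Or.inr hp.le)).congr' ?_
  filter_upwards [hne, hneW] with a ha haW
  exact ((P.logRel_iff v hp (hX a) (hW a) (fun j hj => ha j (hv j hj))
    fun j hj => haW j (hv j hj)).mp (h a) k).symm

variable (P)

/-! ### Entropy minimization -/

/-- The tangent line inequality for the convex function `y log y - y - c y`, whose derivative is
`log y - c`. The value `a = 0` is allowed, so that a minimizer may still be on the boundary. -/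
lemma entropy_gradient_le {a b c : ℝ} (ha : 0 ≤ a) (hb : 0 < b) :
    (Real.log b - c) * (a - b) ≤
      (a * Real.log a - a - c * a) - (b * Real.log b - b - c * b) := by
  suffices a - b ≤ a * (Real.log a - Real.log b) by linarith
  rcases ha.eq_or_lt with rfl | ha
  · simpa using hb.le
  · have h := Real.one_sub_inv_le_log_of_pos (div_pos ha hb)
    rw [Real.log_div ha.ne' hb.ne', inv_div] at h
    calc a - b = a * (1 - b / a) := by field_simp
      _ ≤ _ := by gcongr

lemma exists_logRel_of_pos {p : ℝ} (hp : 0 < p) {x : Fin n → ℝ} (hx : ∀ i, 0 < P.y i x) :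
    ∃ w ∈ P.carrier, P.LogRel p x w := by
  set c : Fin m → ℝ := fun i => p * Real.log (P.y i x) with hc
  let f : (Fin n → ℝ) → ℝ := fun w =>
    ∑ i, (P.y i w * Real.log (P.y i w) - P.y i w - c i * P.y i w)
  have hfc : Continuous f := continuous_finsetSum _ fun i _ =>
    ((Real.continuous_mul_log.comp (P.y_continuous i)).sub (P.y_continuous i)).sub
      ((P.y_continuous i).const_mul _)
  have hxP : x ∈ P.carrier := fun i => (hx i).le
  obtain ⟨w, hw, hmin⟩ := P.isCompact_carrier.exists_isMinOn ⟨x, hxP⟩ hfc.continuousOn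
  refine ⟨w, hw, ?_⟩
  -- The minimizer is approached along the segment from the interior point `x`, where the entropy is
  -- differentiable.
  let t : ℕ → ℝ := fun k => 1 / ((k : ℝ) + 1)
  have ht0 : ∀ k, 0 < t k := fun k => by positivity
  have ht1 : ∀ k, t k ≤ 1 := fun k => by
    rw [div_le_one (by positivity)]
    linarith [(k.cast_nonneg : (0 : ℝ) ≤ k)]
  have hty : ∀ k i, P.y i (w + t k • (x - w)) = (1 - t k) * P.y i w + t k * P.y i x := by
    intro k i
    rw [P.y_add_smul, P.mulVec_sub_apply]
    ring
  have hpos : ∀ k i, 0 < P.y i (w + t k • (x - w)) := fun k i => by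
    rw [hty]
    exact add_pos_of_nonneg_of_pos (mul_nonneg (sub_nonneg.mpr (ht1 k)) (hw i))
      (mul_pos (ht0 k) (hx i))
  have hwpos : ∀ i, P.y i w ≠ 0 := fun i => by
    have tW : Tendsto (fun k => w + t k • (x - w)) atTop (𝓝 w) := by
      have := (tendsto_one_div_add_atTop_nhds_zero_nat (𝕜 := ℝ)).smul_const (x - w)
      simpa [t] using this.const_add w
    refine P.y_ne_zero_of_tendsto hp hxP (X := fun _ => x)
      (fun _ => hxP) (fun k i => (hpos k i).le) tendsto_const_nhds tW
      (Eventually.of_forall fun k i _ => (hpos k i).ne') (Eventually.of_forall fun k => ?_)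
      (hx i).ne'
    have h1 : f w ≤ f (w + t k • (x - w)) := hmin fun i => (hpos k i).le
    have h2 : ∑ i, (Real.log (P.y i (w + t k • (x - w))) - c i) *
        (P.y i w - P.y i (w + t k • (x - w))) ≤ f w - f (w + t k • (x - w)) := by
      simp only [f, ← Finset.sum_sub_distrib]
      exact Finset.sum_le_sum fun i _ => entropy_gradient_le (hw i) (hpos k i)
    have h3 : ∑ i, (Real.log (P.y i (w + t k • (x - w))) - c i) *
        (P.y i w - P.y i (w + t k • (x - w))) = -t k * ∑ i, (P.y i x - P.y i w) *
          (Real.log (P.y i (w + t k • (x - w))) - c i) := by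
      rw [Finset.mul_sum]
      refine Finset.sum_congr rfl fun i _ => ?_
      rw [hty]
      ring
    -- By convexity and minimality, the entropy has nonnegative slope in the direction from `w` to
    -- `x` at each point of the segment.
    have h4 : 0 ≤ ∑ i, (P.y i x - P.y i w) *
          (Real.log (P.y i (w + t k • (x - w))) - c i) := by
      by_contra! h
      nlinarith [mul_pos_of_neg_of_neg (neg_lt_zero.mpr (ht0 k)) h]
    have h5 : ∑ i, (P.y i x - P.y i (w + t k • (x - w))) *
        (Real.log (P.y i (w + t k • (x - w))) - p * Real.log (P.y i x)) =
        (1 - t k) * ∑ i, (P.y i x - P.y i w) *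
          (Real.log (P.y i (w + t k • (x - w))) - c i) := by
      rw [Finset.mul_sum]
      refine Finset.sum_congr rfl fun i _ => ?_
      rw [hty, hc]
      ring
    rw [h5]
    exact mul_nonneg (sub_nonneg.mpr (ht1 k)) h4
  refine ⟨fun i => iff_of_false (hx i).ne' (hwpos i), fun d _ => ?_⟩
  have hyd : ∀ i, HasDerivAt (fun s : ℝ => P.y i (w + s • d)) ((P.A *ᵥ d) i) 0 := fun i => by
    simp only [P.y_add_smul]
    simpa using ((hasDerivAt_id (0 : ℝ)).mul_const ((P.A *ᵥ d) i)).const_add (P.y i w)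
  have hder : HasDerivAt (fun s : ℝ => f (w + s • d))
      (∑ i, (P.A *ᵥ d) i * (Real.log (P.y i w) - c i)) 0 := by
    refine HasDerivAt.fun_sum fun i _ => ?_
    have h0 : P.y i (w + (0 : ℝ) • d) ≠ 0 := by simpa using hwpos i
    refine ((((Real.hasDerivAt_mul_log h0).comp (0 : ℝ) (hyd i)).sub (hyd i)).sub
      ((hyd i).const_mul (c i))).congr_deriv ?_
    rw [zero_smul, add_zero]
    ring
  refine IsLocalMin.hasDerivAt_eq_zero ?_ hder
  have hev : ∀ᶠ s : ℝ in 𝓝 0, ∀ i, 0 < P.y i (w + s • d) := by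
    rw [eventually_all]
    intro i
    have hc : Continuous fun s : ℝ => P.y i (w + s • d) :=
      (P.y_continuous i).comp (by fun_prop)
    refine (hc.tendsto 0).eventually (lt_mem_nhds ?_)
    simpa using lt_of_le_of_ne (hw i) (hwpos i).symm
  filter_upwards [hev] with s hs
  have : f w ≤ f (w + s • d) := hmin fun i => (hs i).le
  simpa using this

/-- Boundary points are limits of interior ones; a subsequence of the interior solutions converges
by compactness, and the relation passes to the limit. -/
lemma exists_logRel {p : ℝ} (hp : 0 < p) {x : Fin n → ℝ} (hx : x ∈ P.carrier) :
    ∃ w ∈ P.carrier, P.LogRel p x w := by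
  obtain ⟨x₀, hx₀⟩ := P.exists_interior_point
  let t : ℕ → ℝ := fun k => 1 / ((k : ℝ) + 1)
  have ht0 : ∀ k, 0 < t k := fun k => by positivity
  have ht1 : ∀ k, t k ≤ 1 := fun k => by
    rw [div_le_one (by positivity)]
    linarith [(k.cast_nonneg : (0 : ℝ) ≤ k)]
  have hpos : ∀ k i, 0 < P.y i (x + t k • (x₀ - x)) := fun k i => by
    have : P.y i (x + t k • (x₀ - x)) = (1 - t k) * P.y i x + t k * P.y i x₀ := by
      rw [P.y_add_smul, P.mulVec_sub_apply]
      ring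
    rw [this]
    exact add_pos_of_nonneg_of_pos (mul_nonneg (sub_nonneg.mpr (ht1 k)) (hx i))
      (mul_pos (ht0 k) (hx₀ i))
  have tX : Tendsto (fun k => x + t k • (x₀ - x)) atTop (𝓝 x) := by
    have := (tendsto_one_div_add_atTop_nhds_zero_nat (𝕜 := ℝ)).smul_const (x₀ - x)
    simpa [t] using this.const_add x
  choose W hW hXW using fun k => P.exists_logRel_of_pos hp (hpos k)
  obtain ⟨w, hw, φ, hφ, tW⟩ := P.isCompact_carrier.tendsto_subseq hW
  exact ⟨w, hw, LogRel.of_tendsto hp hx hw (fun k i => (hpos (φ k) i).le) (fun k => hW (φ k))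
    (tX.comp hφ.tendsto_atTop) tW fun k => hXW (φ k)⟩

/-- The map of `P` that takes `x` to the solution `w` of `∑ aᵢ log yᵢ(w) = p ∑ aᵢ log yᵢ(x)`. -/
def powerMap {p : ℝ} (hp : 0 < p) (x : P.carrier) : P.carrier :=
  ⟨(P.exists_logRel hp x.2).choose, (P.exists_logRel hp x.2).choose_spec.1⟩

lemma powerMap_spec {p : ℝ} (hp : 0 < p) (x : P.carrier) :
    P.LogRel p x.1 (P.powerMap hp x).1 :=
  (P.exists_logRel hp x.2).choose_spec.2

lemma powerMap_eq {p : ℝ} (hp : 0 < p) {x w : P.carrier} (h : P.LogRel p x.1 w.1) :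
    P.powerMap hp x = w :=
  Subtype.ext ((P.powerMap_spec hp x).unique (Subtype.mem _) w.2 h)

/-- A map into a compact space with closed graph is continuous: every ultrafilter limit of values
satisfies the relation, so it is the value. -/
lemma powerMap_continuous {p : ℝ} (hp : 0 < p) : Continuous (P.powerMap hp) := by
  have : CompactSpace P.carrier := isCompact_iff_compactSpace.mp P.isCompact_carrier
  rw [continuous_iff_ultrafilter]
  intro x g hg
  obtain ⟨w, -, hw⟩ := isCompact_univ.ultrafilter_le_nhds (g.map (P.powerMap hp)) (by simp)
  have : P.powerMap hp x = w := P.powerMap_eq hp <| LogRel.of_tendsto (l := (g : Filter P.carrier))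
    hp x.2 w.2 (fun a => a.2) (fun a => (P.powerMap hp a).2)
    ((continuous_subtype_val.tendsto x).mono_left hg)
    ((continuous_subtype_val.tendsto w).comp hw) (P.powerMap_spec hp)
  rw [this]
  exact hw

/-- The homeomorphism `powerMap` with its inverse. -/
def powerHomeomorph {p : ℝ} (hp : 0 < p) : P.carrier ≃ₜ P.carrier where
  toFun := P.powerMap hp
  invFun := P.powerMap (inv_pos.mpr hp)
  left_inv x := P.powerMap_eq _ ((P.powerMap_spec hp x).symm hp)
  right_inv x := P.powerMap_eq _ <| by
    simpa only [inv_inv] using (P.powerMap_spec (inv_pos.mpr hp) x).symm (inv_pos.mpr hp)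
  continuous_toFun := P.powerMap_continuous hp
  continuous_invFun := P.powerMap_continuous (inv_pos.mpr hp)

/-! ### Toric coordinates in the linear and in the quadratic charts -/

/-- The `N`-th roots of the toric coordinates, as functions of the coordinates
`s_k = y_k ^ (1 / N)`. -/
def toricMap (N : ℕ) (v : P.Vertex) (s : EuclideanSpace ℝ (Fin n)) : EuclideanSpace ℝ (Fin n) :=
  WithLp.toLp 2 fun k =>
    s k * Real.exp ((N : ℝ)⁻¹ * P.toricExponent v (P.point v fun l => s l ^ N) k)

lemma y_point_pow (N : ℕ) (v : P.Vertex) (j : Fin m) (s : EuclideanSpace ℝ (Fin n)) :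
    P.y j (P.point v fun l => s l ^ N) =
      P.y j (P.point v 0) + ∑ l, P.vertexCoeff v j l * s l ^ N := by
  rw [← P.y_point_add_smul, zero_add]

lemma toricMap_contDiffAt (N : ℕ) (v : P.Vertex) {s : EuclideanSpace ℝ (Fin n)}
    (hs : ∀ j ∉ P.active v.1, P.y j (P.point v fun l => s l ^ N) ≠ 0) :
    ContDiffAt ℝ ω (P.toricMap N v) s := by
  refine contDiffAt_euclidean.mpr fun k => ?_
  have h : ∀ l : Fin n, ContDiffAt ℝ ω (fun s : EuclideanSpace ℝ (Fin n) => s l) s :=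
    fun l => by fun_prop
  refine (h k).mul (Real.contDiff_exp.contDiffAt.comp _ (contDiffAt_const.mul ?_))
  refine ContDiffAt.sum fun j hj => contDiffAt_const.mul ?_
  refine ContDiffAt.log ?_ (hs j (Finset.mem_compl.mp hj))
  simp only [P.y_point_pow]
  exact contDiffAt_const.add (ContDiffAt.sum fun l _ => contDiffAt_const.mul ((h l).pow N))

/-- Pairing the kernel equation with `s_k^(N-1) σ_k / s_k` gives `∑ s_k^(N-1) σ_k² / s_k + ∑ Bⱼ² /
Yⱼ = 0`, a sum of nonnegative terms. Where `s_k = 0` the kernel equation itself reads `σ_k = 0`. -/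
lemma toricMap_fderiv_injective {N : ℕ} (hN : N ≠ 0) (v : P.Vertex)
    {s : EuclideanSpace ℝ (Fin n)} (hs0 : ∀ k, 0 ≤ s k)
    (hs : ∀ j ∉ P.active v.1, 0 < P.y j (P.point v fun l => s l ^ N)) :
    Function.Injective (fderiv ℝ (P.toricMap N v) s) := by
  rw [injective_iff_map_eq_zero]
  intro σ hσ
  have hN' : (N : ℝ) ≠ 0 := Nat.cast_ne_zero.mpr hN
  set Y : Fin m → ℝ := fun j => P.y j (P.point v fun l => s l ^ N) with hY
  -- This is the derivative of `s_l ^ N` without its factor `N`, which cancels the `N⁻¹` in the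
  -- exponent of `toricMap`.
  set τ : Fin n → ℝ := fun l => s l ^ (N - 1) * σ l with hτ
  set B : Fin m → ℝ := fun j => ∑ l, P.vertexCoeff v j l * τ l with hB
  have hproj : ∀ {f : ℝ → EuclideanSpace ℝ (Fin n)} {f' : EuclideanSpace ℝ (Fin n)},
      HasDerivAt f f' 0 → ∀ k, HasDerivAt (fun t => f t k) (f' k) 0 := fun hf k =>
    (EuclideanSpace.proj (𝕜 := ℝ) k).hasFDerivAt.comp_hasDerivAt (0 : ℝ) hf
  have hγ : HasDerivAt (fun t : ℝ => s + t • σ) σ 0 := by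
    simpa using ((hasDerivAt_id (0 : ℝ)).smul_const σ).const_add s
  have hγ0 : s + (0 : ℝ) • σ = s := by simp
  have hγk : ∀ k, HasDerivAt (fun t : ℝ => (s + t • σ) k) (σ k) 0 := fun k =>
    hproj hγ k
  have hYd : ∀ j, HasDerivAt (fun t : ℝ => P.y j (P.point v fun l => (s + t • σ) l ^ N))
      (N * B j) 0 := fun j => by
    simp only [P.y_point_pow]
    refine ((HasDerivAt.fun_sum fun l _ => ((hγk l).fun_pow N).const_mul _).const_add _).congr_deriv
      ?_
    rw [hB, Finset.mul_sum, hγ0]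
    exact Finset.sum_congr rfl fun l _ => by rw [hτ]; ring
  have hSd : ∀ k, HasDerivAt (fun t : ℝ => (N : ℝ)⁻¹ *
      P.toricExponent v (P.point v fun l => (s + t • σ) l ^ N) k)
      (∑ j ∈ (P.active v.1)ᶜ, P.vertexCoeff v j k * (B j / Y j)) 0 := fun k => by
    refine ((HasDerivAt.fun_sum fun j hj => (((hYd j).log ?_).const_mul _)).const_mul _).congr_deriv
      ?_
    · rw [hγ0]
      exact (hs j (Finset.mem_compl.mp hj)).ne'
    · rw [Finset.mul_sum, hγ0]
      refine Finset.sum_congr rfl fun j _ => ?_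
      change _ = P.vertexCoeff v j k * (B j / P.y j (P.point v fun l => s l ^ N))
      field_simp
  have hcomp : HasDerivAt (fun t : ℝ => P.toricMap N v (s + t • σ)) 0 0 := by
    have h1 : HasFDerivAt (P.toricMap N v) (fderiv ℝ (P.toricMap N v) s) (s + (0 : ℝ) • σ) := by
      rw [hγ0]
      exact ((P.toricMap_contDiffAt N v fun j hj => (hs j hj).ne').differentiableAt
        (by simp)).hasFDerivAt
    have := h1.comp_hasDerivAt (0 : ℝ) hγ
    rwa [hσ] at this
  have hk : ∀ k, σ k + s k * ∑ j ∈ (P.active v.1)ᶜ, P.vertexCoeff v j k * (B j / Y j) = 0 := by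
    intro k
    have h1 := (hγk k).mul (hSd k).exp
    have h2 := h1.unique (hproj hcomp k)
    rw [hγ0] at h2
    have h3 := Real.exp_pos ((N : ℝ)⁻¹ * P.toricExponent v (P.point v fun l => s l ^ N) k)
    refine (mul_eq_zero.mp (?_ : Real.exp ((N : ℝ)⁻¹ *
      P.toricExponent v (P.point v fun l => s l ^ N) k) * _ = 0)).resolve_left h3.ne'
    rw [PiLp.zero_apply] at h2
    rw [← h2]
    ring
  -- At `s_k = 0` the quotient is `0` by convention, which agrees with the left side because `σ_k =
  -- 0` there.
  have hterm : ∀ k, τ k * ∑ j ∈ (P.active v.1)ᶜ, P.vertexCoeff v j k * (B j / Y j) =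
      -(s k ^ (N - 1) * σ k ^ 2 / s k) := by
    intro k
    rcases (hs0 k).eq_or_lt with h | h
    · have : σ k = 0 := by simpa [← h] using hk k
      simp [hτ, this]
    · have : ∑ j ∈ (P.active v.1)ᶜ, P.vertexCoeff v j k * (B j / Y j) = -(σ k / s k) := by
        have := hk k
        field_simp at this ⊢
        linarith
      rw [this]
      ring
  have hsum : ∑ k, s k ^ (N - 1) * σ k ^ 2 / s k =
      -∑ j ∈ (P.active v.1)ᶜ, B j ^ 2 / Y j := by
    rw [eq_comm, neg_eq_iff_eq_neg, ← Finset.sum_neg_distrib]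
    simp only [← hterm, Finset.mul_sum]
    rw [Finset.sum_comm]
    refine Finset.sum_congr rfl fun j _ => ?_
    rw [sq, mul_div_assoc]
    nth_rewrite 1 [hB]
    rw [Finset.sum_mul]
    exact Finset.sum_congr rfl fun k _ => by ring
  have hnonneg : ∀ k ∈ Finset.univ, 0 ≤ s k ^ (N - 1) * σ k ^ 2 / s k := fun k _ =>
    div_nonneg (mul_nonneg (pow_nonneg (hs0 k) _) (sq_nonneg _)) (hs0 k)
  have hzero : ∑ k, s k ^ (N - 1) * σ k ^ 2 / s k = 0 := by
    refine le_antisymm ?_ (Finset.sum_nonneg hnonneg)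
    rw [hsum, neg_nonpos]
    exact Finset.sum_nonneg fun j hj =>
      div_nonneg (sq_nonneg _) (hs j (Finset.mem_compl.mp hj)).le
  ext k
  rcases (hs0 k).eq_or_lt with h | h
  · simpa [← h] using hk k
  · have := (Finset.sum_eq_zero_iff_of_nonneg hnonneg).mp hzero k (Finset.mem_univ k)
    simpa [h.ne'] using this

end SimplePolytope

/-- To check smoothness it suffices to use, for each chart `ψ` of the target, one chart of the source
that contains the preimage of the domain of `ψ`. -/
lemma CornerStructure.isSmooth_of_charts {n : ℕ} {Q Q' : Type*} [TopologicalSpace Q]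
    [TopologicalSpace Q'] {S : CornerStructure n Q} {S' : CornerStructure n Q'} {F : C(Q, Q')}
    (h : ∀ ψ ∈ S'.charts, ∃ θ ∈ S.charts, (∀ x, F x ∈ ψ.source → x ∈ θ.source) ∧
      SmoothOnQuadrant (fun q => ψ (F (θ.symm q))) {q ∈ θ.target | F (θ.symm q) ∈ ψ.source}) :
    S.IsSmooth S' F := by
  intro φ hφ ψ hψ
  obtain ⟨θ, hθ, hsource, hsmooth⟩ := h ψ hψ
  have hinv : ∀ q ∈ {q ∈ φ.target | F (φ.symm q) ∈ ψ.source},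
      θ.symm (θ (φ.symm q)) = φ.symm q := fun q hq => θ.left_inv (hsource _ hq.2)
  refine (SmoothOnQuadrant.comp hsmooth ((S.compatible φ hφ θ hθ).mono
    fun q hq => ⟨hq.1, hsource _ hq.2⟩) fun q hq => ⟨?_, ?_⟩).congr fun q hq => ?_
  · exact θ.map_source (hsource _ hq.2)
  · rw [hinv q hq]
    exact hq.2
  · simp only [hinv q hq]

namespace SimplePolytope

variable {n m : ℕ} (P : SimplePolytope n m)

/-! ### The diffeomorphism -/

/-- A chart on `P_v` with coordinates `y_k ^ (1 / N)`, `k ∈ ω_v`. -/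
structure IsRootChart (N : ℕ) (v : P.Vertex)
    (φ : OpenPartialHomeomorph P.carrier (EuclideanQuadrant n)) : Prop where
  source_eq : φ.source = {x | ∀ j ∉ P.active v.1, P.y j x.1 ≠ 0}
  pow_eq : ∀ x k, (φ x).1 k ^ N = P.y (P.idx v k) x.1

lemma linearChart_isRootChart (v : P.Vertex) : P.IsRootChart 1 v (P.linearChart v) :=
  ⟨rfl, fun x k => by rw [pow_one, P.linearChart_apply]⟩

lemma quadraticChart_isRootChart (v : P.Vertex) : P.IsRootChart 2 v (P.quadraticChart v) :=
  ⟨rfl, fun x k => by rw [P.quadraticChart_apply, Real.sq_sqrt (x.2 _)]⟩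

variable {P}

lemma IsRootChart.point_eq {N : ℕ} {v : P.Vertex}
    {φ : OpenPartialHomeomorph P.carrier (EuclideanQuadrant n)} (h : P.IsRootChart N v φ)
    (x : P.carrier) : P.point v (fun l => (φ x).1 l ^ N) = x.1 := by
  simp only [h.pow_eq, P.point_y]

lemma IsRootChart.y_pos {N : ℕ} {v : P.Vertex}
    {φ : OpenPartialHomeomorph P.carrier (EuclideanQuadrant n)} (h : P.IsRootChart N v φ)
    {x : P.carrier} (hx : x ∈ φ.source) (j : Fin m) (hj : j ∉ P.active v.1) :
    0 < P.y j (P.point v fun l => (φ x).1 l ^ N) := by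
  rw [h.source_eq] at hx
  rw [h.point_eq]
  exact lt_of_le_of_ne (x.2 j) (hx j hj).symm

lemma IsRootChart.toricMap_nonneg {N : ℕ} {v : P.Vertex}
    {φ : OpenPartialHomeomorph P.carrier (EuclideanQuadrant n)}
    (x : P.carrier) (k : Fin n) : 0 ≤ P.toricMap N v (φ x).1 k :=
  mul_nonneg ((φ x).2 k) (Real.exp_pos _).le

/-- Together with nonnegativity, this identifies `toricMap` in a root chart as the true `N`-th root
of the toric coordinates, so equations can be compared after taking powers. -/
lemma IsRootChart.toricMap_pow {N : ℕ} (hN : N ≠ 0) {v : P.Vertex}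
    {φ : OpenPartialHomeomorph P.carrier (EuclideanQuadrant n)} (h : P.IsRootChart N v φ)
    (x : P.carrier) (k : Fin n) : P.toricMap N v (φ x).1 k ^ N = P.toricCoord v x.1 k := by
  have hN' : (N : ℝ) ≠ 0 := Nat.cast_ne_zero.mpr hN
  simp only [toricMap, toricCoord]
  rw [h.point_eq, mul_pow, h.pow_eq, ← Real.exp_nat_mul, mul_inv_cancel_left₀ hN']

/-- A map that preserves the toric coordinates of a vertex is smooth near that vertex. -/
lemma IsRootChart.smoothOnQuadrant {N M : ℕ} (hM : M ≠ 0) {v : P.Vertex}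
    {φ ψ : OpenPartialHomeomorph P.carrier (EuclideanQuadrant n)} (hφ : P.IsRootChart N v φ)
    (hψ : P.IsRootChart M v ψ) {F : P.carrier → P.carrier} (hF : Continuous F)
    (h : ∀ x ∈ φ.source, P.toricMap M v (ψ (F x)).1 = P.toricMap N v (φ x).1) :
    SmoothOnQuadrant (fun q => ψ (F (φ.symm q))) {q ∈ φ.target | F (φ.symm q) ∈ ψ.source} := by
  refine SmoothOnQuadrant.of_implicit (K := P.toricMap N v) (H := P.toricMap M v) ?_
    (fun q hq => ?_) (fun q hq => ?_) (fun q hq => ?_) fun q hq => ?_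
  · exact ψ.continuousOn.comp (hF.comp_continuousOn (φ.continuousOn_symm.mono fun q hq => hq.1))
      fun q hq => hq.2
  · rw [← φ.right_inv hq.1]
    exact P.toricMap_contDiffAt N v fun j hj => (hφ.y_pos (φ.map_target hq.1) j hj).ne'
  · exact P.toricMap_contDiffAt M v fun j hj => (hψ.y_pos hq.2 j hj).ne'
  · exact P.toricMap_fderiv_injective hM v (ψ (F (φ.symm q))).2 (hψ.y_pos hq.2)
  · rw [h _ (φ.map_target hq.1), φ.right_inv hq.1]

variable (P)

/-- Faces are preserved, so each `P_v` is mapped to itself and smoothness can be checked one vertex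
at a time. -/
lemma powerMap_ne_zero_iff {p : ℝ} (hp : 0 < p) (v : P.Vertex) (x : P.carrier) :
    (∀ j ∉ P.active v.1, P.y j (P.powerMap hp x).1 ≠ 0) ↔ ∀ j ∉ P.active v.1, P.y j x.1 ≠ 0 :=
  forall₂_congr fun j _ => not_congr ((P.powerMap_spec hp x).1 j).symm

/-- In the toric coordinates of the linear and of the quadratic chart, `powerMap` with exponent `2`
is the identity. -/
lemma toricMap_powerMap_two (v : P.Vertex) {x : P.carrier}
    (hx : ∀ j ∉ P.active v.1, P.y j x.1 ≠ 0) :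
    P.toricMap 2 v (P.quadraticChart v (P.powerMap two_pos x)).1 =
      P.toricMap 1 v (P.linearChart v x).1 := by
  ext k
  have h1 := (P.quadraticChart_isRootChart v).toricMap_pow two_ne_zero (P.powerMap two_pos x) k
  have h2 := (P.linearChart_isRootChart v).toricMap_pow one_ne_zero x k
  have h3 := (P.logRel_iff v two_pos x.2 (P.powerMap two_pos x).2 hx
    ((P.powerMap_ne_zero_iff two_pos v x).mpr hx)).mp (P.powerMap_spec two_pos x) k
  rw [pow_one] at h2
  rw [← h1, ← h2, Real.rpow_two] at h3
  exact (pow_left_inj₀ (IsRootChart.toricMap_nonneg _ k) (IsRootChart.toricMap_nonneg _ k)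
    two_ne_zero).mp h3

lemma powerHomeomorph_isDiffeomorphism :
    P.linearStructure.IsDiffeomorphism P.quadraticStructure (P.powerHomeomorph two_pos) := by
  constructor
  · refine CornerStructure.isSmooth_of_charts ?_
    rintro _ ⟨v, rfl⟩
    refine ⟨P.linearChart v, ⟨v, rfl⟩, fun x => (P.powerMap_ne_zero_iff two_pos v x).mp, ?_⟩
    exact (P.linearChart_isRootChart v).smoothOnQuadrant two_ne_zero
      (P.quadraticChart_isRootChart v) (P.powerHomeomorph two_pos).continuous
      fun x hx => P.toricMap_powerMap_two v hx
  · refine CornerStructure.isSmooth_of_charts ?_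
    rintro _ ⟨v, rfl⟩
    refine ⟨P.quadraticChart v, ⟨v, rfl⟩,
      fun x => (P.powerMap_ne_zero_iff (inv_pos.mpr two_pos) v x).mp, ?_⟩
    refine (P.quadraticChart_isRootChart v).smoothOnQuadrant one_ne_zero
      (P.linearChart_isRootChart v) (P.powerHomeomorph two_pos).symm.continuous fun x hx => ?_
    -- The coordinate identity for the inverse is the one for exponent `2`, read at the preimage of
    -- `x`.
    have := P.toricMap_powerMap_two v
      ((P.powerMap_ne_zero_iff (inv_pos.mpr two_pos) v x).mpr hx)
    have h2 : P.powerMap two_pos (P.powerMap (inv_pos.mpr two_pos) x) = x :=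
      (P.powerHomeomorph two_pos).apply_symm_apply x
    rw [h2] at this
    exact this.symm

end SimplePolytope

end PolytopeCorners

end

/-- A simple polytope with its linear smooth structure is diffeomorphic, as a manifold with
corners, to the same polytope with its quadratic smooth structure. -/
theorem mainTheorem3 {n m : ℕ} (P : PolytopeCorners.SimplePolytope n m) :
    ∃ F : P.carrier ≃ₜ P.carrier,
      P.linearStructure.IsDiffeomorphism P.quadraticStructure F :=
  ⟨P.powerHomeomorph two_pos, P.powerHomeomorph_isDiffeomorphism⟩
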